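/- Let $T$ be a complete first-order theory in a language $L$, put $|T|=|L|+\aleph_0$, and let $\mathfrak C$ be a monster model of $T$, that is, a nonempty $\kappa$-saturated and strongly $\kappa$-homogeneous model for some $\kappa>|T|$. Types are in finitely many variables, and $S(A)$ is the set of complete types over $A$. For a type $p(x)$ over a model $M\models T$ and a finite set $\Delta$ of formulas, let $\mathrm{uf}_\Delta(p)$ be the set of complete global $\Delta$-types $q(x)$ (with the variables of the formulas in $\Delta$ divided in all ways between $x$ and the parameters) such that $q\cup p$ is finitely satisfiable in $M$; here global types are over a monster model in which $M$ is a small elementary submodel. The theory $T$ has *small* directionality if $\mathrm{uf}_\Delta(p)$ is finite for all finite $\Delta$, all $M\models T$ and all $p\in S(M)$; it has *medium* directionality if for every $\lambda\ge|T|$, $\lambda=\sup\{|\mathrm{uf}_\Delta(p)| : p\in S(M),\ M\models T,\ |M|=\lambda,\ \Delta\text{ finite}\}$; it has *large* directionality if it is neither small nor medium. A global type $p\in S(\mathfrak C)$ *splits* over a model $M\prec\mathfrak C$ if there are a formula $\varphi(x,y)$ and tuples $b,c$ from $\mathfrak C$ with $\mathrm{tp}(b/M)=\mathrm{tp}(c/M)$,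 $\varphi(x,b)\in p$ and $\varphi(x,c)\notin p$. It *splinters* over $M$ if there is $\sigma\in\mathrm{Aut}(\mathfrak C)$ such that $\sigma(p)\ne p$, $\sigma(p|_M)=p|_M$ and $\sigma(M)=M$ setwise. **Theorem.** Suppose that $T$ has medium or large directionality (that is, $T$ does not have small directionality). Then splitting and splintering over models differ: there are a model $M\prec\mathfrak C$ and a global type $p\in S(\mathfrak C)$ such that $p$ does not split over $M$ but splinters over $M$. Moreover, $M$ can be chosen with $|M|=|T|$. -/

import Mathlib

open FirstOrder Cardinal

universe u v w

namespace Directionality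

/-- The cardinal `|T|` of a theory in the language `L`: the number of `L`-formulas, `|L| + ℵ₀`. -/
noncomputable def theoryCard (L : FirstOrder.Language.{u, v}) : Cardinal.{max u v} :=
  max ℵ₀ L.card

section Types

variable {L : FirstOrder.Language.{u, v}} {C : Type w} [L.Structure C] {n : ℕ}

/-- The formulas `φ(x, a)` in `x = (x₀, …, xₙ₋₁)` with parameters `a` in `A ⊆ C`.  Throughout, a
formula with parameters in `C` is an `L`-formula whose free variables are elements of `C`
(the parameters, interpreted as themselves) and the variables `xᵢ`. -/
def formulasOver (L : FirstOrder.Language.{u, v}) (n : ℕ) (A : Set C) : Set (L.Formula (C ⊕ Fin n)) :=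
  Set.range fun φ : L.Formula (A ⊕ Fin n) => φ.relabel (Sum.map Subtype.val id)

/-- The tuple `a` satisfies the formula `φ(x)` with parameters in `C`. -/
def Sat (φ : L.Formula (C ⊕ Fin n)) (a : Fin n → C) : Prop :=
  φ.Realize (Sum.elim id a)

/-- A set of formulas is finitely satisfiable in `A`: each finite part is satisfied by a tuple
from `A`. -/
def FinSatIn (A : Set C) (p : Set (L.Formula (C ⊕ Fin n))) : Prop :=
  ∀ F : Finset (L.Formula (C ⊕ Fin n)), (F : Set (L.Formula (C ⊕ Fin n))) ⊆ p →
    ∃ a : Fin n → C, (∀ i, a i ∈ A) ∧ ∀ φ ∈ F, Sat φ a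

/-- `p ∈ S(A)`: `p` is a complete type over `A` in the variables `x₀, …, xₙ₋₁`. -/
structure IsCompleteType (A : Set C) (p : Set (L.Formula (C ⊕ Fin n))) : Prop where
  subset : p ⊆ formulasOver L n A
  consistent : FinSatIn Set.univ p
  complete : ∀ φ ∈ formulasOver L n A, φ ∈ p ∨ φ.not ∈ p

/-- `tp(b / A)`. -/
def tp (L : FirstOrder.Language.{u, v}) [L.Structure C] (A : Set C) (b : Fin n → C) :
    Set (L.Formula (C ⊕ Fin n)) :=
  {φ | φ ∈ formulasOver L n A ∧ Sat φ b}

/-- The restriction `p|_A`. -/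
def restrict (p : Set (L.Formula (C ⊕ Fin n))) (A : Set C) : Set (L.Formula (C ⊕ Fin n)) :=
  p ∩ formulasOver L n A

/-- The image `σ(p) = {φ(x, σ(a)) : φ(x, a) ∈ p}` under an automorphism `σ` of `C`. -/
def autImage (σ : C ≃[L] C) (p : Set (L.Formula (C ⊕ Fin n))) : Set (L.Formula (C ⊕ Fin n)) :=
  (fun φ => φ.relabel (Sum.map σ id)) '' p

/-- The global type `p` splits over `A`: there are `φ(x, y)` and tuples `b`, `c` with the same type
over `A` such that `φ(x, b) ∈ p` and `φ(x, c) ∉ p`. -/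
def Splits (p : Set (L.Formula (C ⊕ Fin n))) (A : Set C) : Prop :=
  ∃ (m : ℕ) (φ : L.Formula (Fin m ⊕ Fin n)) (b c : Fin m → C), tp L A b = tp L A c ∧
    φ.relabel (Sum.map b id) ∈ p ∧ φ.relabel (Sum.map c id) ∉ p

/-- The global type `p` splinters over `M`: some automorphism `σ` of `C` has `σ(p) ≠ p`,
`σ(p|_M) = p|_M` and `σ(M) = M` setwise. -/
def Splinters (p : Set (L.Formula (C ⊕ Fin n))) (M : Set C) : Prop :=
  ∃ σ : C ≃[L] C, autImage σ p ≠ p ∧ autImage σ (restrict p M) = restrict p M ∧ σ '' M = M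

/-- For a set `Δ` of formulas, the instances `φ(x, a)` with `φ ∈ Δ`, the variables of `φ` being
divided in any way between the variables `x` and parameters from `A`. -/
def instances (Δ : Set (L.Formula ℕ)) (n : ℕ) (A : Set C) : Set (L.Formula (C ⊕ Fin n)) :=
  {ψ | ∃ φ ∈ Δ, ∃ s : ℕ → A ⊕ Fin n, ψ = φ.relabel (Sum.map Subtype.val id ∘ s)}

/-- `q ∈ S_Δ(A)`: `q` is a complete `L_Δ(A)`-type in `x₀, …, xₙ₋₁`, where `L_Δ(A)` consists of
the instances `φ(x, a)` of `Δ` over `A` and their negations. -/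
structure IsCompleteLocalType (Δ : Set (L.Formula ℕ)) (A : Set C)
    (q : Set (L.Formula (C ⊕ Fin n))) : Prop where
  subset : ∀ ψ ∈ q, ψ ∈ instances Δ n A ∨ ∃ θ ∈ instances Δ n A, ψ = θ.not
  consistent : FinSatIn Set.univ q
  complete : ∀ θ ∈ instances Δ n A, θ ∈ q ∨ θ.not ∈ q

/-- `uf_Δ(p)` for `p` over `A`: the `q ∈ S_Δ(C)` such that `q ∪ p` is finitely satisfiable
in `A`. -/
def uf (Δ : Set (L.Formula ℕ)) (A : Set C) (p : Set (L.Formula (C ⊕ Fin n))) :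
    Set (Set (L.Formula (C ⊕ Fin n))) :=
  {q | IsCompleteLocalType Δ Set.univ q ∧ FinSatIn A (q ∪ p)}

end Types

/-- `C` is a monster model of `T`, with `κ > |T|` the bound for smallness: a `κ`-saturated and
strongly `κ`-homogeneous model of `T`. -/
structure IsMonster {L : FirstOrder.Language.{u, v}} (T : L.Theory) (κ : Cardinal.{max u v w})
    (C : Type (max u v w)) [L.Structure C] : Prop where
  nonempty : Nonempty C
  model : T.Model C
  card_lt : Cardinal.lift.{w} (theoryCard L) < κ
  /-- Types in finitely many variables over fewer than `κ` parameters are realized. -/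
  saturated : ∀ A : Set C, #A < κ → ∀ (n : ℕ) (p : Set (L.Formula (C ⊕ Fin n))),
    p ⊆ formulasOver L n A → FinSatIn Set.univ p → ∃ a : Fin n → C, ∀ φ ∈ p, Sat φ a
  /-- Elementary maps defined on fewer than `κ` elements extend to automorphisms. -/
  homogeneous : ∀ A : Set C, #A < κ → ∀ f : A → C,
    (∀ φ : L.Formula A, φ.Realize (Subtype.val : A → C) ↔ φ.Realize f) →
      ∃ σ : C ≃[L] C, ∀ a : A, σ a = f a

section Theories

variable {L : FirstOrder.Language.{u, v}}

/-- The cardinal `μ` is `|uf_Δ(p)|` for some finite `Δ`, some `M ⊨ T` with `|M| = l` and some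
`p ∈ S(M)`, computed in a monster model in which `M` is small. -/
def IsCoheirCount (T : L.Theory) (l μ : Cardinal.{max u v w}) : Prop :=
  ∃ (C : Type (max u v w)) (_ : L.Structure C) (κ : Cardinal.{max u v w})
    (M : L.ElementarySubstructure C) (n : ℕ) (p : Set (L.Formula (C ⊕ Fin n)))
    (Δ : Finset (L.Formula ℕ)),
    IsMonster.{u, v, w} T κ C ∧ #M < κ ∧ #M = l ∧ IsCompleteType (M : Set C) p ∧
      μ = #(uf (Δ : Set (L.Formula ℕ)) (M : Set C) p)

/-- Small directionality: all `uf_Δ(p)`, with `Δ` finite and `p` over a model, are finite. -/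
def HasSmallDirectionality (T : L.Theory) : Prop :=
  ∀ l μ : Cardinal.{max u v w}, IsCoheirCount.{u, v, w} T l μ → μ < ℵ₀

/-- Medium directionality: for every `l ≥ |T|`, the supremum of the `|uf_Δ(p)|`, with `Δ` finite
and `p` over a model of cardinality `l`, is `l`. -/
def HasMediumDirectionality (T : L.Theory) : Prop :=
  ∀ l : Cardinal.{max u v w}, Cardinal.lift.{w} (theoryCard L) ≤ l →
    IsLUB {μ : Cardinal.{max u v w} | IsCoheirCount.{u, v, w} T l μ} l

/-- Large directionality: neither small nor medium. -/
def HasLargeDirectionality (T : L.Theory) : Prop :=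
  ¬ HasSmallDirectionality.{u, v, w} T ∧ ¬ HasMediumDirectionality.{u, v, w} T

end Theories

end Directionality

/-! Failure of small directionality gives a type tp(d/M'), in a monster model C' that may differ
from C, with infinitely many Δ-coheirs. Extend them to ultrafilters Q_k on tuples from M'. For k ≠ l
some θ_kl(x, b_kl), with θ_kl in a fixed finite set of formulas, holds Q_k-almost everywhere but not
Q_l-almost everywhere.

Spread the indices k along a linear order J of size |T| with a fixed-point-free automorphism τ. An
ultrafilter V on ℕ^J, built from iterated limits of a nonprincipal ultrafilter, is invariant under τ
on finitely determined events and makes distinct coordinates differ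
(`exists_invariant_ultrafilter`). Skolem terms in d, in elements m_k of M' at k = ω(j), and in b_kl
at k = ω(j), l = ω(τ j), thereby have a τ-invariant average type, which C realizes
(`exists_realization`). The terms with values in M' yield a model M of size |T|. By homogeneity τ
induces an automorphism σ of C that preserves M and fixes the realization of d.

By finiteness θ_kl is almost always one formula θ₀ along (j₀, τ j₀). With B the realized parameter
tuple for this pair, σ(B) belongs to (τ j₀, τ² j₀). The coheir with the middle index ω(τ j₀) rejects
θ₀(x, B) and accepts θ₀(x, σ(B)), so tp(d/M) with ¬θ₀(x, B) and θ₀(x, σ(B)) is finitely satisfiable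
in M. A global coheir p extending this set does not split over M. Also σ fixes p|_M = tp(d/M), while
σ(p) ≠ p (`exists_not_splits_splinters`). -/

namespace Directionality

open Language

/-! ### Iterated ultrafilter limits along a linear order -/

section IteratedLimit

variable {J : Type*}

/-- The distribution of the point obtained from `ω` by replacing the coordinates in `l`, in the
order of the list, by `U`-generic ones. -/
def iteratedLimit [DecidableEq J] (U : Ultrafilter ℕ) : List J → (J → ℕ) → Ultrafilter (J → ℕ)
  | [], ω => pure ω
  | j :: l, ω => U.bind fun k => iteratedLimit U l (Function.update ω j k)

theorem eventually_iteratedLimit_nil [DecidableEq J] (U : Ultrafilter ℕ) (ω : J → ℕ)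
    (A : (J → ℕ) → Prop) : (∀ᶠ x in iteratedLimit U [] ω, A x) ↔ A ω :=
  Filter.eventually_pure

theorem eventually_iteratedLimit_cons [DecidableEq J] (U : Ultrafilter ℕ) (j : J) (l : List J)
    (ω : J → ℕ) (A : (J → ℕ) → Prop) :
    (∀ᶠ x in iteratedLimit U (j :: l) ω, A x) ↔
      ∀ᶠ k in U, ∀ᶠ x in iteratedLimit U l (Function.update ω j k), A x :=
  Iff.rfl

theorem eventually_iteratedLimit_congr [DecidableEq J] (U : Ultrafilter ℕ) {S : Set J}
    {A : (J → ℕ) → Prop} (hA : DependsOn A S) (l : List J) (ω ω' : J → ℕ)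
    (h : ∀ j ∈ S, j ∉ l → ω j = ω' j) :
    (∀ᶠ x in iteratedLimit U l ω, A x) ↔ ∀ᶠ x in iteratedLimit U l ω', A x := by
  induction l generalizing ω ω' with
  | nil =>
    simp only [eventually_iteratedLimit_nil]
    exact iff_of_eq (hA fun j hj => h j hj (by simp))
  | cons i l ih =>
    simp only [eventually_iteratedLimit_cons]
    refine Filter.eventually_congr (Filter.Eventually.of_forall fun k => ih _ _ fun j hj hjl => ?_)
    by_cases hji : j = i
    · subst hji; simp
    · simpa [hji] using h j hj (by simp [hji, hjl])

/-- Redrawing a coordinate outside `S` does not affect `A`, so its quantifier is vacuous. Hence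
limits along different finite sets of coordinates are compatible. -/
theorem eventually_iteratedLimit_filter [DecidableEq J] (U : Ultrafilter ℕ) {S : Set J}
    [DecidablePred (· ∈ S)]
    {A : (J → ℕ) → Prop} (hA : DependsOn A S) (l : List J) (ω : J → ℕ) :
    (∀ᶠ x in iteratedLimit U l ω, A x) ↔
      ∀ᶠ x in iteratedLimit U (l.filter (· ∈ S)) ω, A x := by
  induction l generalizing ω with
  | nil => rfl
  | cons i l ih =>
    by_cases hi : i ∈ S
    · rw [List.filter_cons_of_pos (by simpa using hi)]
      simp only [eventually_iteratedLimit_cons]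
      exact Filter.eventually_congr (Filter.Eventually.of_forall fun k => ih _)
    · rw [List.filter_cons_of_neg (by simpa using hi), eventually_iteratedLimit_cons]
      have : ∀ k, (∀ᶠ x in iteratedLimit U l (Function.update ω i k), A x) ↔
          ∀ᶠ x in iteratedLimit U (l.filter (· ∈ S)) ω, A x := fun k => by
        rw [ih]
        refine eventually_iteratedLimit_congr U hA _ _ _ fun j hj _ => ?_
        rw [Function.update_of_ne]
        rintro rfl
        exact hi hj
      simp only [this, Filter.eventually_const]

theorem eventually_iteratedLimit_map [DecidableEq J] (U : Ultrafilter ℕ) (τ : J ≃ J)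
    (A : (J → ℕ) → Prop) (l : List J) (ω : J → ℕ) :
    (∀ᶠ x in iteratedLimit U (l.map τ) ω, A (x ∘ τ)) ↔
      ∀ᶠ x in iteratedLimit U l (ω ∘ τ), A x := by
  induction l generalizing ω with
  | nil => exact Iff.rfl
  | cons i l ih =>
    simp only [List.map_cons, eventually_iteratedLimit_cons]
    refine Filter.eventually_congr (Filter.Eventually.of_forall fun k => ?_)
    rw [ih, Function.update_comp_eq_of_injective _ τ.injective]

/-- An ultrafilter on `ℕ^J` which is invariant, on events that depend on finitely many coordinates,
under the automorphisms of the linear order `J`. -/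
theorem exists_invariant_ultrafilter (J : Type*) [LinearOrder J] :
    ∃ V : Ultrafilter (J → ℕ),
      (∀ (τ : J ≃o J) (A : (J → ℕ) → Prop), (∃ S : Finset J, DependsOn A S) →
        ((∀ᶠ ω in V, A (ω ∘ τ)) ↔ ∀ᶠ ω in V, A ω)) ∧
      ∀ i j, i ≠ j → ∀ᶠ ω : J → ℕ in V, ω i ≠ ω j := by
  classical
  let U : Ultrafilter ℕ := Filter.hyperfilter ℕ
  let ω₀ : J → ℕ := fun _ => 0
  let W : Ultrafilter (Finset J) := Ultrafilter.of Filter.atTop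
  -- A limit over ever larger finite sets: an event determined by `S` is decided by the iterated
  -- limit along `S` itself, whatever the choice of `W`.
  let V : Ultrafilter (J → ℕ) := W.bind fun S => iteratedLimit U (S.sort) ω₀
  have key : ∀ (A : (J → ℕ) → Prop) (S : Finset J), DependsOn A (S : Set J) →
      ((∀ᶠ ω in V, A ω) ↔ ∀ᶠ ω in iteratedLimit U S.sort ω₀, A ω) := by
    intro A S hA
    change (∀ᶠ R in (W : Filter (Finset J)), ∀ᶠ ω in iteratedLimit U R.sort ω₀, A ω) ↔ _
    have hW : ∀ᶠ R in (W : Filter (Finset J)), S ⊆ R :=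
      Ultrafilter.of_le _ (Filter.eventually_ge_atTop S)
    have : ∀ᶠ R in (W : Filter (Finset J)), ((∀ᶠ ω in iteratedLimit U R.sort ω₀, A ω) ↔
        ∀ᶠ ω in iteratedLimit U S.sort ω₀, A ω) := by
      filter_upwards [hW] with R hR
      rw [eventually_iteratedLimit_filter U hA]
      have : R.sort.filter (· ∈ (S : Set J)) = S.sort := by
        refine List.Perm.eq_of_pairwise' ((R.pairwise_sort _).filter _) (S.pairwise_sort _) ?_
        refine (List.perm_ext_iff_of_nodup ((R.sort_nodup _).filter _) (S.sort_nodup _)).2 ?_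
        intro a
        simpa using fun h => hR h
      rw [this]
    rw [Filter.eventually_congr this, Filter.eventually_const]
  refine ⟨V, ?_, ?_⟩
  · rintro τ A ⟨S, hA⟩
    have hA' : DependsOn (fun ω => A (ω ∘ τ)) ((S.map τ.toEquiv.toEmbedding : Finset J) : Set J) := by
      intro x y hxy
      refine hA fun i hi => hxy _ ?_
      simpa using hi
    rw [key _ _ hA', key _ _ hA]
    have : (S.map τ.toEquiv.toEmbedding).sort = S.sort.map τ.toEquiv := by
      symm
      exact Finset.map_sort _ _ _ _ fun a _ b _ => (τ.le_iff_le).symm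
    rw [this]
    exact eventually_iteratedLimit_map U τ.toEquiv A _ _
  · have lt : ∀ i j, i < j → ∀ᶠ ω : J → ℕ in V, ω i ≠ ω j := by
      intro i j hij
      have hd : DependsOn (fun ω : J → ℕ => ω i ≠ ω j) (({i, j} : Finset J) : Set J) := by
        intro x y hxy
        simp only [hxy i (by simp), hxy j (by simp)]
      rw [key _ _ hd, Finset.sort_insert _ (by simpa using hij.le) (by simpa using hij.ne),
        Finset.sort_singleton]
      simp only [eventually_iteratedLimit_cons, eventually_iteratedLimit_nil,
        Function.update_self, Function.update_of_ne hij.ne]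
      refine Filter.Eventually.of_forall fun k => ?_
      have : ∀ᶠ m in Filter.cofinite, m ≠ k := (Set.finite_singleton k).compl_mem_cofinite
      filter_upwards [Filter.hyperfilter_le_cofinite this] with m hm using Ne.symm hm
    intro i j hij
    rcases lt_or_gt_of_ne hij with h | h
    · exact lt i j h
    · exact (lt j i h).mono fun ω hω => hω.symm

end IteratedLimit

/-! ### Functoriality of relabelling and finite support of formulas -/

section Formulas

variable {L : FirstOrder.Language.{u, v}}

/-- Types are sets of formulas, not of equivalence classes, so relabelling has to be functorial up
to equality. The form with `mapTermRel` composes strictly, apart from a cast that is trivial for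
formulas. -/
theorem boundedFormula_relabel_sumInl_comp {α β : Type*} {k : ℕ} (f : α → β)
    (φ : L.BoundedFormula α k) :
    φ.relabel (n := 0) (Sum.inl ∘ f) =
      (φ.mapTermRel (L' := L) (g := id) (fun _ t => t.relabel (Sum.map f id)) (fun _ => id)
        fun _ => id).castLE (ge_of_eq (zero_add k)) := by
  have aux : ∀ k, BoundedFormula.relabelAux (n := 0) (Sum.inl ∘ f) k =
      Sum.map id (Fin.castLE (ge_of_eq (zero_add k))) ∘ Sum.map f id := by
    intro k
    ext (i | i) <;> simp [BoundedFormula.relabelAux]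
    ext; simp
  induction φ with
  | falsum => rfl
  | equal => simp [BoundedFormula.relabel, BoundedFormula.mapTermRel, aux]
  | rel => simp [BoundedFormula.relabel, BoundedFormula.mapTermRel, aux]; ext; simp
  | imp _ _ ih1 ih2 => simp [BoundedFormula.mapTermRel, ih1, ih2]
  | all _ ih => simp [BoundedFormula.mapTermRel, ih]

theorem formula_relabel_eq {α β : Type*} (f : α → β) (φ : L.Formula α) :
    φ.relabel f = BoundedFormula.mapTermRel (L' := L) (g := id)
      (fun _ t => t.relabel (Sum.map f id)) (fun _ => id) (fun _ => id) φ :=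
  (boundedFormula_relabel_sumInl_comp f φ).trans (BoundedFormula.castLE_rfl _ _)

theorem formula_relabel_relabel {α β γ : Type*} (f : α → β) (g : β → γ) (φ : L.Formula α) :
    (φ.relabel f).relabel g = φ.relabel (g ∘ f) := by
  simp only [formula_relabel_eq]
  refine (BoundedFormula.mapTermRel_mapTermRel _ _ _ _ _).trans ?_
  simp [Function.comp_def]

theorem formula_relabel_id {α : Type*} (φ : L.Formula α) : φ.relabel id = φ := by
  rw [formula_relabel_eq]
  refine Eq.trans ?_ (BoundedFormula.mapTermRel_id_id_id φ)
  simp only [Sum.map_id_id, Term.relabel_id]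
  rfl

theorem mem_formulasOver_univ {C : Type*} {n : ℕ} (φ : L.Formula (C ⊕ Fin n)) : φ ∈ formulasOver L n Set.univ :=
  ⟨φ.relabel (Sum.map (fun c => ⟨c, trivial⟩) id), by
    refine (formula_relabel_relabel _ _ _).trans ?_
    rw [Sum.map_comp_map]
    exact (congrArg (fun f => φ.relabel f) Sum.map_id_id).trans (formula_relabel_id φ)⟩

/-- A formula involves finitely many of its free variables. -/
theorem exists_finite_formula_sum {γ β : Type*} (φ : L.Formula (γ ⊕ β)) :
    ∃ (k : ℕ) (t : Fin k → γ) (φ' : L.Formula (Fin k ⊕ β)),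
      ∀ {N : Type w} [L.Structure N] (v : γ → N) (x : β → N),
        φ.Realize (Sum.elim v x) ↔ φ'.Realize (Sum.elim (v ∘ t) x) := by
  classical
  let S := φ.freeVarFinset.toLeft
  let e := S.equivFin
  refine ⟨S.card, fun i => (e.symm i).1, φ.restrictFreeVar fun y => Sum.casesOn y.1
    (fun g hg => Sum.inl (e ⟨g, by simpa [S] using hg⟩)) (fun b _ => Sum.inr b) y.2, ?_⟩
  intro N _ v x
  refine (BoundedFormula.realize_restrictFreeVar (Sum.elim v x) ?_).symm
  rintro ⟨g | b, h⟩ <;> simp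

theorem exists_finite_formula {γ : Type*} (φ : L.Formula γ) :
    ∃ (k : ℕ) (t : Fin k → γ) (φ' : L.Formula (Fin k)),
      ∀ {N : Type w} [L.Structure N] (v : γ → N), φ.Realize v ↔ φ'.Realize (v ∘ t) := by
  obtain ⟨k, t, φ', h⟩ := exists_finite_formula_sum.{u, v, w} (φ.relabel (Sum.inl : γ → γ ⊕ Empty))
  refine ⟨k, t, φ'.relabel (Sum.elim id Empty.elim), fun {N} _ v => ?_⟩
  have := h v (Empty.elim : Empty → N)
  rw [Formula.realize_relabel, Sum.elim_comp_inl] at this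
  rw [this, Formula.realize_relabel]
  refine iff_of_eq (congrArg _ ?_)
  ext (i | i)
  · rfl
  · exact i.elim

end Formulas

/-! ### Realizing average types in a monster model -/

section Realization

variable {L : FirstOrder.Language.{u, v}} {T : L.Theory} {κ : Cardinal.{max u v w}}
  {C : Type (max u v w)} [L.Structure C] {C' : Type (max u v w)} [L.Structure C'] {Ω : Type*}
  {X : Type (max u v w)}

/-- The graph `G` of a partial map from a family of `Ω`-indexed elements of `C'` to `C` preserves
the formulas that hold almost everywhere. -/
def IsElementaryGraph (L : FirstOrder.Language.{u, v}) [L.Structure C] [L.Structure C']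
    (V : Ultrafilter Ω) (val : X → Ω → C') (G : Set (X × C)) : Prop :=
  ∀ φ : L.Formula G, φ.Realize (fun g : G => g.1.2) ↔
    ∀ᶠ ω in V, φ.Realize (fun g : G => val g.1.1 ω)

/-- Completeness of `T` enters here: it is what links the otherwise unrelated models `C` and `C'`.
-/
theorem IsElementaryGraph.empty (hT : T.IsComplete) [C ⊨ T] [C' ⊨ T] [Nonempty C] [Nonempty C']
    (V : Ultrafilter Ω) (val : X → Ω → C') : IsElementaryGraph L V val (∅ : Set (X × C)) := by
  intro φ
  let ψ : L.Sentence := Formula.relabel (fun g => (g.2 : False).elim) φ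
  have h1 : φ.Realize (fun g : (∅ : Set (X × C)) => g.1.2) ↔ C ⊨ ψ := by
    rw [Sentence.Realize, Formula.realize_relabel]
    exact iff_of_eq (congrArg _ (funext fun g => (g.2 : False).elim))
  have h2 : ∀ ω, φ.Realize (fun g : (∅ : Set (X × C)) => val g.1.1 ω) ↔ C' ⊨ ψ := fun ω => by
    rw [Sentence.Realize, Formula.realize_relabel]
    exact iff_of_eq (congrArg _ (funext fun g => (g.2 : False).elim))
  simp only [h1, h2, Filter.eventually_const, hT.realize_sentence_iff]

theorem IsElementaryGraph.injOn_fst {V : Ultrafilter Ω} {val : X → Ω → C'} {G : Set (X × C)}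
    (hG : IsElementaryGraph L V val G) : Set.InjOn Prod.fst G := by
  rintro ⟨x, c⟩ hc ⟨y, d⟩ hd (rfl : x = y)
  have := hG (Term.equal (Term.var ⟨_, hc⟩) (Term.var ⟨_, hd⟩))
  simp only [Formula.realize_equal, Term.realize_var] at this
  simpa using this

/-- One-point extension by saturation. The average type of `val x` over the graph is consistent,
because existential formulas transfer along `G`. -/
theorem IsElementaryGraph.exists_insert (hC : IsMonster.{u, v, w} T κ C) (hX : #X < κ)
    {V : Ultrafilter Ω} {val : X → Ω → C'} {G : Set (X × C)} (hG : IsElementaryGraph L V val G)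
    (x : X) : ∃ c, IsElementaryGraph L V val (insert (x, c) G) := by
  classical
  have hA : #(Prod.snd '' G) < κ := by
    refine (mk_image_le.trans ?_).trans_lt hX
    exact mk_le_of_injective (f := fun g : G => g.1.1)
      fun g h e => Subtype.ext (hG.injOn_fst g.2 h.2 e)
  let π : Set (L.Formula (C ⊕ Fin 1)) := {ψ | ∃ φ : L.Formula (G ⊕ Fin 1),
    ψ = φ.relabel (Sum.map (fun g : G => g.1.2) id) ∧
      ∀ᶠ ω in V, φ.Realize (Sum.elim (fun g : G => val g.1.1 ω) fun _ => val x ω)}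
  have hrel : ∀ (φ : L.Formula (G ⊕ Fin 1)) (a : Fin 1 → C),
      Sat (φ.relabel (Sum.map (fun g : G => g.1.2) id)) a ↔
        φ.Realize (Sum.elim (fun g : G => g.1.2) a) := by
    intro φ a
    rw [Sat, Formula.realize_relabel, Sum.elim_comp_map, Function.id_comp, Function.comp_id]
  obtain ⟨a, ha⟩ : ∃ a : Fin 1 → C, ∀ ψ ∈ π, Sat ψ a := by
    refine hC.saturated _ hA 1 π ?_ ?_
    · rintro _ ⟨φ, rfl, -⟩
      exact ⟨φ.relabel (Sum.map (fun g : G => ⟨g.1.2, Set.mem_image_of_mem _ g.2⟩) id),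
        formula_relabel_relabel _ _ _ |>.trans (by rw [Sum.map_comp_map]; rfl)⟩
    · intro F hF
      have hF' : ∀ ψ : F, _ := fun ψ => hF ψ.2
      choose f hf using hF'
      let Φ : L.Formula (G ⊕ Fin 1) := Formula.iInf f
      have h1 : (Φ.iExs (Fin 1)).Realize (fun g : G => g.1.2) := by
        rw [hG]
        have : ∀ᶠ ω in V, ∀ ψ, (f ψ).Realize
            (Sum.elim (fun g : G => val g.1.1 ω) fun _ => val x ω) :=
          Filter.eventually_all.2 fun ψ => (hf ψ).2
        filter_upwards [this] with ω hω
        rw [Formula.realize_iExs]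
        exact ⟨fun _ => val x ω, by simpa only [Φ, Formula.realize_iInf] using hω⟩
      obtain ⟨a, ha⟩ := Formula.realize_iExs.1 h1
      refine ⟨a, fun _ => trivial, fun ψ hψ => ?_⟩
      rw [show ψ = _ from (hf ⟨ψ, hψ⟩).1, hrel]
      simp only [Φ, Formula.realize_iInf] at ha
      exact ha ⟨ψ, hψ⟩
  -- This direction suffices: its instance for the negated formula gives the converse, `V` being an
  -- ultrafilter.
  have hpos : ∀ φ : L.Formula (G ⊕ Fin 1),
      (∀ᶠ ω in V, φ.Realize (Sum.elim (fun g : G => val g.1.1 ω) fun _ => val x ω)) →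
        φ.Realize (Sum.elim (fun g : G => g.1.2) a) :=
    fun φ hφ => (hrel φ a).1 (ha _ ⟨φ, rfl, hφ⟩)
  refine ⟨a 0, fun φ => ?_⟩
  let r : (insert (x, a 0) G : Set (X × C)) → G ⊕ Fin 1 := fun g =>
    if h : g.1 ∈ G then Sum.inl ⟨g.1, h⟩ else Sum.inr 0
  have hr1 : (Sum.elim (fun g : G => g.1.2) a) ∘ r = fun g => g.1.2 := by
    funext g
    by_cases h : g.1 ∈ G
    · simp [r, h]
    · have := g.2.resolve_right h
      simp only [Function.comp_apply, r, h, dite_false, Sum.elim_inr]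
      rw [this]
  have hr2 : ∀ ω, (Sum.elim (fun g : G => val g.1.1 ω) fun _ => val x ω) ∘ r =
      fun g => val g.1.1 ω := by
    intro ω
    funext g
    by_cases h : g.1 ∈ G
    · simp [r, h]
    · have := g.2.resolve_right h
      simp only [Function.comp_apply, r, h, dite_false, Sum.elim_inr]
      rw [this]
  have h1 := hpos (φ.relabel r)
  have h2 := hpos (φ.relabel r).not
  simp only [Formula.realize_not, Formula.realize_relabel, hr1, hr2, Ultrafilter.eventually_not]
    at h1 h2
  exact ⟨fun h => not_not.1 fun h' => h2 h' h, h1⟩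

/-- A formula mentions finitely many points, and these lie together in one member of the chain. -/
theorem IsElementaryGraph.sUnion {V : Ultrafilter Ω} {val : X → Ω → C'} {c : Set (Set (X × C))}
    (hc : IsChain (· ⊆ ·) c) (hne : c.Nonempty) (h : ∀ G ∈ c, IsElementaryGraph L V val G) :
    IsElementaryGraph L V val (⋃₀ c) := by
  intro φ
  obtain ⟨k, t, φ', hφ⟩ := exists_finite_formula.{u, v, max u v w} φ
  obtain ⟨G, hG, htG⟩ : ∃ G ∈ c, ∀ i, (t i).1 ∈ G := by
    have : (Set.range fun i => (t i).1).Finite := Set.finite_range _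
    obtain ⟨G, hG, h⟩ := DirectedOn.exists_mem_subset_of_finite_of_subset_sUnion hne hc.directedOn this
      (by rintro _ ⟨i, rfl⟩; exact (t i).2)
    exact ⟨G, hG, fun i => h ⟨i, rfl⟩⟩
  have := h G hG (φ'.relabel fun i => ⟨(t i).1, htG i⟩)
  simp only [Formula.realize_relabel] at this
  simp only [hφ]
  exact this

/-- A monster model realizes every small family of almost everywhere defined elements of another
model. -/
theorem exists_realization (hT : T.IsComplete) (hC : IsMonster.{u, v, w} T κ C) [C' ⊨ T]
    [Nonempty C'] (V : Ultrafilter Ω) (hX : #X < κ) (val : X → Ω → C') :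
    ∃ ι : X → C, ∀ φ : L.Formula X, φ.Realize ι ↔ ∀ᶠ ω in V, φ.Realize (fun x => val x ω) := by
  have := hC.model
  have := hC.nonempty
  obtain ⟨G, -, hG⟩ := zorn_subset_nonempty {G : Set (X × C) | IsElementaryGraph L V val G}
    (fun c hc hchain hne => ⟨⋃₀ c, IsElementaryGraph.sUnion hchain hne hc,
      fun s hs => Set.subset_sUnion_of_mem hs⟩) ∅ (IsElementaryGraph.empty hT V val)
  have htot : ∀ x, ∃ c, (x, c) ∈ G := fun x => by
    obtain ⟨c, hc⟩ := IsElementaryGraph.exists_insert hC hX hG.prop x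
    exact ⟨c, hG.eq_of_subset hc (Set.subset_insert _ _) ▸ Set.mem_insert _ _⟩
  choose ι hι using htot
  refine ⟨ι, fun φ => ?_⟩
  have := hG.prop (φ.relabel fun x => ⟨(x, ι x), hι x⟩)
  simp only [Formula.realize_relabel] at this
  exact this

end Realization

/-! ### Skolem terms with values in a given set -/

section SkolemTerms

variable {L : FirstOrder.Language.{u, v}} {C : Type (max u v w)} [L.Structure C]

/-- The language of the Skolem functions for tuples satisfying an `L`-formula. -/
def skolemLanguage (L : FirstOrder.Language.{u, v}) : FirstOrder.Language.{max u v, 0} where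
  Functions k := Σ n : ℕ, L.Formula (Fin k ⊕ Fin n) × Fin n
  Relations _ := Empty

theorem card_skolemLanguage_functions :
    #(Σ k, (skolemLanguage L).Functions k) ≤ theoryCard L := by
  have hF : ∀ k n : ℕ, #(L.Formula (Fin k ⊕ Fin n) × Fin n) ≤ theoryCard L := by
    intro k n
    have h1 : #(L.Formula (Fin k ⊕ Fin n)) ≤ theoryCard L := by
      have h2 : #(L.Formula (Fin k ⊕ Fin n)) ≤ #(Σ m, L.BoundedFormula (Fin k ⊕ Fin n) m) :=
        mk_le_of_injective (f := fun φ => ⟨0, φ⟩) fun φ ψ h => by simpa using h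
      refine (h2.trans BoundedFormula.card_le).trans ?_
      refine max_le (le_max_left _ _) ?_
      refine add_le_of_le (le_max_left _ _) ?_ ?_
      · refine le_trans ?_ (le_max_left _ _)
        exact lift_le_aleph0.2 mk_le_aleph0
      · simp [theoryCard]
    rw [mk_prod]
    refine mul_le_of_le (le_max_left _ _) (by simpa using h1) ?_
    exact le_trans (by simp) (le_max_left _ _)
  have key : ∀ f : ℕ → Type (max u v), (∀ k, #(f k) ≤ theoryCard L) →
      #(Σ k, f k) ≤ theoryCard L := by
    intro f hf
    rw [mk_sigma]
    refine (sum_le_lift_mk_mul_iSup _).trans ?_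
    refine mul_le_of_le (le_max_left _ _) (by simp [theoryCard]) ?_
    exact ciSup_le' hf
  exact key _ fun k => key _ fun n => hF k n

open Classical in
/-- The interpretation of the Skolem functions choosing, where possible, tuples from `M`. -/
@[reducible] noncomputable def skolemStructure (M : Set C) [Nonempty M] : (skolemLanguage L).Structure C where
  -- The default value is also in `M`, so compound terms always take values in `M`, even when the
  -- variables do not.
  funMap f y := if h : ∃ x : Fin f.1 → C, (∀ i, x i ∈ M) ∧ f.2.1.Realize (Sum.elim y x) then
    h.choose f.2.2 else (Classical.arbitrary M : M)
  RelMap r := r.elim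

/-- The value of a Skolem term. -/
noncomputable def skolemVal (M : Set C) [Nonempty M] {α : Type*} (v : α → C)
    (t : (skolemLanguage L).Term α) : C :=
  letI := skolemStructure (L := L) M
  t.realize v

variable {M : Set C} [Nonempty M] {α : Type*}

theorem skolemVal_relabel (f : α → α) (v : α → C) (t : (skolemLanguage L).Term α) :
    skolemVal M v (t.relabel f) = skolemVal M (v ∘ f) t :=
  letI := skolemStructure (L := L) M
  Term.realize_relabel

/-- The Skolem term for the `i`-th coordinate of a witness of `φ`. -/
def skolemTerm {k n : ℕ} (φ : L.Formula (Fin k ⊕ Fin n)) (ts : Fin k → (skolemLanguage L).Term α)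
    (i : Fin n) : (skolemLanguage L).Term α :=
  Term.func (L := skolemLanguage L) (⟨n, φ, i⟩ : Σ n : ℕ, L.Formula (Fin k ⊕ Fin n) × Fin n) ts

open Classical in
theorem skolemVal_skolemTerm (v : α → C) {k n : ℕ} (φ : L.Formula (Fin k ⊕ Fin n))
    (ts : Fin k → (skolemLanguage L).Term α) (i : Fin n) :
    skolemVal M v (skolemTerm φ ts i) =
      if h : ∃ x : Fin n → C, (∀ i, x i ∈ M) ∧ φ.Realize (Sum.elim (skolemVal M v ∘ ts) x) then
        h.choose i else (Classical.arbitrary M : M) := rfl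

/-- Skolem terms witness the formulas that are satisfied by tuples from `M`. -/
theorem exists_skolemTerm {n : ℕ} (φ : L.Formula ((skolemLanguage L).Term α ⊕ Fin n)) :
    ∃ s : Fin n → (skolemLanguage L).Term α, ∀ v : α → C, (∀ i, skolemVal M v (s i) ∈ M) ∧
      ((∃ x : Fin n → C, (∀ i, x i ∈ M) ∧ φ.Realize (Sum.elim (skolemVal M v) x)) →
        φ.Realize (Sum.elim (skolemVal M v) fun i => skolemVal M v (s i))) := by
  obtain ⟨k, t, φ', hφ⟩ := exists_finite_formula_sum.{u, v, max u v w} φ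
  refine ⟨skolemTerm φ' t, fun v => ⟨fun i => ?_, ?_⟩⟩
  · rw [skolemVal_skolemTerm]
    split_ifs with h
    · exact h.choose_spec.1 _
    · exact Subtype.coe_prop _
  intro h
  simp only [hφ] at h ⊢
  have : (fun i => skolemVal M v (skolemTerm φ' t i)) = h.choose := by
    funext i
    rw [skolemVal_skolemTerm]
    exact dif_pos h
  rw [this]
  exact h.choose_spec.2

/-- Invariance of the ultrafilter on ℕ^J is available only for events determined by finitely many
coordinates. -/
theorem exists_dependsOn_skolemVal {J : Type*} (g : α → (J → ℕ) → C)
    (hg : ∀ a, ∃ S : Finset J, DependsOn (g a) S) (t : (skolemLanguage L).Term α) :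
    ∃ S : Finset J, DependsOn (fun ω => skolemVal M (fun a => g a ω) t) S := by
  classical
  induction t with
  | var a => exact hg a
  | func f ts ih =>
    choose S hS using ih
    refine ⟨Finset.univ.biUnion S, fun x y hxy => ?_⟩
    refine congrArg ((skolemStructure (L := L) M).funMap f) (funext fun i => ?_)
    exact hS i fun j hj => hxy j (by simpa using ⟨i, hj⟩)

theorem exists_dependsOn_formula {J : Type*} {X : Type*} (val : X → (J → ℕ) → C)
    (h : ∀ x, ∃ S : Finset J, DependsOn (val x) S) (φ : L.Formula X) :
    ∃ S : Finset J, DependsOn (fun ω => φ.Realize fun x => val x ω) S := by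
  classical
  obtain ⟨k, t, φ', hφ⟩ := exists_finite_formula.{u, v, max u v w} φ
  choose S hS using h
  refine ⟨Finset.univ.biUnion fun i => S (t i), fun x y hxy => ?_⟩
  simp only [hφ]
  congr 1
  funext i
  exact hS _ fun j hj => hxy j (by simpa using ⟨i, hj⟩)

end SkolemTerms

/-! ### Tarski–Vaught test and the index order -/

/-- A set that contains witnesses for the satisfiable formulas over it is an elementary
substructure. -/
theorem exists_elementarySubstructure {L : FirstOrder.Language.{u, v}} {C : Type w} [L.Structure C]
    {A : Set C} (h : ∀ φ : L.Formula (A ⊕ Fin 1), (∃ x : Fin 1 → C, φ.Realize (Sum.elim Subtype.val x)) →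
      ∃ x : Fin 1 → C, x 0 ∈ A ∧ φ.Realize (Sum.elim Subtype.val x)) :
    ∃ M : L.ElementarySubstructure C, (M : Set C) = A := by
  have hA : L.MeetsDefinable A := by
    rintro D ⟨c, hc⟩ hD
    obtain ⟨φ, hφ⟩ := Set.definable_iff_exists_formula_sum.1 hD
    have hφ' : ∀ x : Fin 1 → C, x 0 ∈ D ↔ φ.Realize (Sum.elim Subtype.val x) := fun x =>
      Set.ext_iff.1 hφ x
    obtain ⟨x, hx, hxφ⟩ := h φ ⟨fun _ => c, (hφ' _).1 hc⟩
    exact ⟨x 0, (hφ' x).2 hxφ, hx⟩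
  exact ⟨hA.toElementarySubstructure, hA.closure_eq_self⟩

/-- There are linear orders of any infinite cardinality with a
fixed-point-free automorphism. -/
theorem exists_linearOrder_orderIso (c : Cardinal.{w}) (hc : ℵ₀ ≤ c) :
    ∃ (J : Type w) (_ : LinearOrder J) (τ : J ≃o J), #J = c ∧ Nonempty J ∧ ∀ j, τ j ≠ j := by
  let A : Type w := c.ord.ToType
  have hA : #A = c := c.mk_ord_toType
  have : Nonempty A := mk_ne_zero_iff.1 (by rw [hA]; exact (aleph0_pos.trans_le hc).ne')
  let τ : (A ×ₗ ℤ) ≃o (A ×ₗ ℤ) :=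
    Prod.Lex.prodLexCongr (OrderIso.refl A) (OrderIso.addRight (1 : ℤ))
  refine ⟨A ×ₗ ℤ, inferInstance, τ, ?_, inferInstanceAs (Nonempty (A × ℤ)), fun j h => ?_⟩
  · have : #(A ×ₗ ℤ) = #(A × ℤ) := rfl
    rw [this, mk_prod, hA]
    simp [hc]
  · have : (ofLex (τ j)).2 = (ofLex j).2 + 1 := rfl
    rw [h] at this
    omega

/-! ### Global coheirs as average types -/

section AverageTypes

variable {L : FirstOrder.Language.{u, v}} {C : Type w} [L.Structure C] {n : ℕ}

theorem sat_relabel_sumMap {D : Type*} (φ : L.Formula (D ⊕ Fin n)) (f : D → C) (a : Fin n → C) :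
    Sat (φ.relabel (Sum.map f id)) a ↔ φ.Realize (Sum.elim f a) := by
  rw [Sat, Formula.realize_relabel, Sum.elim_comp_map, Function.id_comp, Function.comp_id]

/-- The type of the formulas that hold almost everywhere for an ultrafilter on tuples. -/
def averageType (L : FirstOrder.Language.{u, v}) [L.Structure C] (W : Ultrafilter (Fin n → C)) :
    Set (L.Formula (C ⊕ Fin n)) :=
  {ψ | ∀ᶠ a in W, Sat ψ a}

theorem finSatIn_averageType {W : Ultrafilter (Fin n → C)} {A : Set C}
    (hA : ∀ᶠ a : Fin n → C in W, ∀ i, a i ∈ A) : FinSatIn A (averageType L W) := by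
  intro F hF
  have : ∀ᶠ a in W, ∀ ψ ∈ F, Sat ψ a := (Filter.eventually_all_finset F).2 fun ψ hψ => hF hψ
  exact (hA.and this).exists

theorem isCompleteType_averageType (W : Ultrafilter (Fin n → C)) :
    IsCompleteType Set.univ (averageType L W) where
  subset φ _ := mem_formulasOver_univ φ
  consistent := finSatIn_averageType (Filter.Eventually.of_forall fun _ _ => trivial)
  complete φ _ := by
    by_cases h : ∀ᶠ a in W, Sat φ a
    · exact Or.inl h
    · exact Or.inr (Ultrafilter.eventually_not.2 h)

/-- If `φ(x, b)` and `¬φ(x, c)` both hold almost everywhere, a single tuple `a` from `A` satisfies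
both, and `φ(a, y)` separates the types of `b` and `c` over `A`. -/
theorem not_splits_averageType {W : Ultrafilter (Fin n → C)} {A : Set C}
    (hA : ∀ᶠ a : Fin n → C in W, ∀ i, a i ∈ A) : ¬ Splits (averageType L W) A := by
  rintro ⟨m, φ, b, c, hbc, hb, hc⟩
  have hc' := Ultrafilter.eventually_not.2 hc
  obtain ⟨a, ⟨haA, hab⟩, hac⟩ := ((hA.and hb).and hc').exists
  rw [sat_relabel_sumMap] at hab hac
  let χ : L.Formula (C ⊕ Fin m) := Formula.relabel (Sum.map Subtype.val id)
    (φ.relabel (Sum.elim Sum.inr fun i => Sum.inl (⟨a i, haA i⟩ : A)))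
  have hχ : ∀ b : Fin m → C, Sat χ b ↔ φ.Realize (Sum.elim b a) := by
    intro b
    rw [sat_relabel_sumMap, Formula.realize_relabel]
    refine iff_of_eq (congrArg _ ?_)
    ext (i | i) <;> rfl
  have h1 : χ ∈ tp L A b := ⟨⟨_, rfl⟩, (hχ b).2 hab⟩
  rw [hbc] at h1
  exact hac ((hχ c).1 h1.2)

theorem sat_autImage (σ : C ≃[L] C) (ψ : L.Formula (C ⊕ Fin n)) (a : Fin n → C) :
    Sat (ψ.relabel (Sum.map σ id)) (σ ∘ a) ↔ Sat ψ a := by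
  rw [sat_relabel_sumMap, Sat, ← StrongHomClass.realize_formula σ ψ (v := Sum.elim id a)]
  refine iff_of_eq (congrArg _ ?_)
  ext (i | i) <;> rfl

theorem autImage_tp_subset {σ : C ≃[L] C} {A : Set C} (hA : σ '' A = A) {d : Fin n → C}
    (hd : ∀ i, σ (d i) = d i) : autImage σ (tp L A d) ⊆ tp L A d := by
  have hσ : ∀ a : A, σ a ∈ A := fun a => hA.subset (Set.mem_image_of_mem σ a.2)
  rintro _ ⟨_, ⟨⟨φ, rfl⟩, hφ⟩, rfl⟩
  refine ⟨⟨φ.relabel (Sum.map (fun a : A => (⟨σ a, hσ a⟩ : A)) id), ?_⟩, ?_⟩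
  · refine (formula_relabel_relabel _ _ _).trans (Eq.trans ?_ (formula_relabel_relabel _ _ _).symm)
    rw [Sum.map_comp_map, Sum.map_comp_map]
    rfl
  · rw [← sat_autImage σ] at hφ
    rwa [show σ ∘ d = d from funext hd] at hφ

theorem autImage_tp {σ : C ≃[L] C} {A : Set C} (hA : σ '' A = A) {d : Fin n → C}
    (hd : ∀ i, σ (d i) = d i) : autImage σ (tp L A d) = tp L A d := by
  refine (autImage_tp_subset hA hd).antisymm fun ψ hψ => ?_
  have hA' : σ.symm '' A = A := by
    conv_lhs => rw [← hA]
    rw [Set.image_image]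
    simp
  refine ⟨_, autImage_tp_subset (σ := σ.symm) hA' (fun i => ?_) ⟨ψ, hψ, rfl⟩, ?_⟩
  · conv_lhs => rw [← hd i]
    exact σ.symm_apply_apply _
  · refine (formula_relabel_relabel _ _ _).trans ?_
    rw [Sum.map_comp_map, show (σ : C → C) ∘ σ.symm = id from funext σ.apply_symm_apply]
    exact (congrArg (fun f => ψ.relabel f) Sum.map_id_id).trans (formula_relabel_id ψ)

/-- An automorphism fixing a type over `M` and moving one of its coheirs produces a global type
that does not split but splinters over `M`. -/
theorem exists_not_splits_splinters {N : ℕ} {M : Set C} {d : Fin n → C} {σ : C ≃[L] C}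
    (hM : σ '' M = M) (hd : ∀ i, σ (d i) = d i) (θ : L.Formula (Fin N ⊕ Fin n)) (b : Fin N → C)
    (hfs : ∀ ψ ∈ tp L M d, ∃ a : Fin n → C, (∀ i, a i ∈ M) ∧ Sat ψ a ∧
      ¬ θ.Realize (Sum.elim b a) ∧ θ.Realize (Sum.elim (σ ∘ b) a)) :
    ∃ p : Set (L.Formula (C ⊕ Fin n)), IsCompleteType Set.univ p ∧ ¬ Splits p M ∧
      Splinters p M := by
  let E : L.Formula (C ⊕ Fin n) → Set (Fin n → C) := fun ψ => {a | (∀ i, a i ∈ M) ∧ Sat ψ a ∧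
      ¬ θ.Realize (Sum.elim b a) ∧ θ.Realize (Sum.elim (σ ∘ b) a)}
  obtain ⟨W, hW⟩ := Ultrafilter.exists_ultrafilter_of_finite_inter_nonempty (E '' tp L M d) (by
    intro R hR
    have hR' : ∀ s : R, ∃ φ : L.Formula (M ⊕ Fin n), φ.Realize (Sum.elim Subtype.val d) ∧
        E (φ.relabel (Sum.map Subtype.val id)) = s := by
      intro s
      obtain ⟨_, ⟨⟨φ, rfl⟩, hφ⟩, h⟩ := hR s.2
      exact ⟨φ, (sat_relabel_sumMap _ _ _).1 hφ, h⟩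
    choose f hf hfE using hR'
    obtain ⟨a, haM, ha, haθ⟩ := hfs ((Formula.iInf f).relabel (Sum.map Subtype.val id))
      ⟨⟨_, rfl⟩, by rw [sat_relabel_sumMap, Formula.realize_iInf]; exact hf⟩
    rw [sat_relabel_sumMap, Formula.realize_iInf] at ha
    refine ⟨a, fun s hs => ?_⟩
    rw [show s = _ from (hfE ⟨s, hs⟩).symm]
    exact ⟨haM, (sat_relabel_sumMap _ _ _).2 (ha _), haθ⟩)
  have hWE : ∀ ψ ∈ tp L M d, ∀ᶠ a in W, a ∈ E ψ := fun ψ hψ => hW ⟨ψ, hψ, rfl⟩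
  have htop : (⊤ : L.Formula (M ⊕ Fin n)).relabel (Sum.map Subtype.val id) ∈ tp L M d :=
    ⟨⟨_, rfl⟩, by rw [sat_relabel_sumMap]; exact Formula.realize_top.2 trivial⟩
  have hWM : ∀ᶠ a : Fin n → C in W, ∀ i, a i ∈ M := (hWE _ htop).mono fun a ha => ha.1
  refine ⟨averageType L W, isCompleteType_averageType W, not_splits_averageType hWM, σ, ?_, ?_, hM⟩
  · intro h
    have h1 : θ.relabel (Sum.map (σ ∘ b) id) ∈ averageType L W :=
      (hWE _ htop).mono fun a ha => (sat_relabel_sumMap _ _ _).2 ha.2.2.2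
    rw [← h] at h1
    -- Only the image of `ψ` under `σ` is known to be `θ(x, σ(b))`. Transporting by `σ` shows that
    -- `ψ` is equivalent to `θ(x, b)`, which fails almost everywhere.
    obtain ⟨ψ, hψ, hψθ⟩ := h1
    have h2 : ∀ᶠ a in W, Sat ψ a := hψ
    obtain ⟨a, haψ, ha⟩ := (h2.and (hWE _ htop)).exists
    refine ha.2.2.1 ?_
    rw [← sat_autImage σ] at haψ
    dsimp only at hψθ
    rw [hψθ, sat_relabel_sumMap] at haψ
    rw [← StrongHomClass.realize_formula σ]
    convert haψ using 1
    ext (i | i) <;> rfl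
  · have : restrict (averageType L W) M = tp L M d := by
      ext ψ
      refine ⟨fun ⟨h, hψ⟩ => ⟨hψ, ?_⟩, fun h => ⟨(hWE ψ h).mono fun a ha => ha.2.1, h.1⟩⟩
      by_contra hd'
      obtain ⟨φ, rfl⟩ := hψ
      have hnot : φ.not.relabel (Sum.map Subtype.val id) ∈ tp L M d :=
        ⟨⟨_, rfl⟩, by
          rw [sat_relabel_sumMap, Formula.realize_not]
          exact fun h => hd' ((sat_relabel_sumMap _ _ _).2 h)⟩
      have h2 : ∀ᶠ a in W, Sat (φ.relabel (Sum.map Subtype.val id)) a := h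
      obtain ⟨a, ha, ha'⟩ := (h2.and (hWE _ hnot)).exists
      have := ha'.2.1
      rw [sat_relabel_sumMap, Formula.realize_not] at this
      exact this ((sat_relabel_sumMap _ _ _).1 ha)
    rw [this, autImage_tp hM hd]

end AverageTypes

/-! ### The model with an automorphism that moves a coheir -/

section Construction

variable {L : FirstOrder.Language.{u, v}}

theorem exists_mem_realize {C : Type*} [L.Structure C] (M : L.ElementarySubstructure C) {k n : ℕ}
    (φ : L.Formula (Fin k ⊕ Fin n)) (y : Fin k → C) (hy : ∀ i, y i ∈ M)
    (h : ∃ x : Fin n → C, φ.Realize (Sum.elim y x)) :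
    ∃ x : Fin n → C, (∀ i, x i ∈ M) ∧ φ.Realize (Sum.elim y x) := by
  let y' : Fin k → M := fun i => ⟨y i, hy i⟩
  have h1 : (φ.iExs (Fin n)).Realize (M.subtype ∘ y') := Formula.realize_iExs.2 h
  rw [M.subtype.map_formula, Formula.realize_iExs] at h1
  obtain ⟨x, hx⟩ := h1
  refine ⟨fun i => x i, fun i => (x i).2, ?_⟩
  rw [← M.subtype.map_formula] at hx
  convert hx using 1
  ext (i | i) <;> rfl

theorem card_skolemTerm_le {α : Type (max u v w)} {c : Cardinal.{max u v w}}
    (hc : Cardinal.lift.{w} (theoryCard L) = c) (hα : #α ≤ c) :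
    #((skolemLanguage L).Term α) ≤ c := by
  have h0 : ℵ₀ ≤ c := by
    rw [← hc, aleph0_le_lift]; exact le_max_left _ _
  refine Term.card_le.trans (max_le h0 ?_)
  rw [mk_sum]
  refine add_le_of_le h0 ?_ ?_
  · exact (lift_id'.{max u v, w} #α).trans_le hα
  · rw [← hc, lift_umax.{max u v, w}]
    exact lift_le.{w}.2 card_skolemLanguage_functions

variable {T : L.Theory} {κ : Cardinal.{max u v w}} {C : Type (max u v w)} [L.Structure C]
  {C' : Type (max u v w)} [L.Structure C']

/-- An infinite family of coheirs of `tp(d/M')`, pairwise distinguished by instances of finitely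
many formulas, leads to a type that does not split but splinters over a model of size `|T|`. -/
theorem exists_model_not_splits_splinters (hT : T.IsComplete) (hC : IsMonster.{u, v, w} T κ C)
    [C' ⊨ T] [Nonempty C'] (M' : L.ElementarySubstructure C') {n N : ℕ} (d : Fin n → C')
    (Q : ℕ → Ultrafilter (Fin n → C')) (hQM : ∀ k, ∀ᶠ a : Fin n → C' in Q k, ∀ i, a i ∈ M')
    (hQd : ∀ k, tp L (M' : Set C') d ⊆ averageType L (Q k))
    (F : Set (L.Formula (Fin N ⊕ Fin n))) (hFfin : F.Finite)
    (hF : ∀ k l, k ≠ l → ∃ θ ∈ F, ∃ b : Fin N → C', (∀ᶠ a in Q k, θ.Realize (Sum.elim b a)) ∧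
      ¬ ∀ᶠ a in Q l, θ.Realize (Sum.elim b a)) :
    ∃ (M : L.ElementarySubstructure C) (p : Set (L.Formula (C ⊕ Fin n))),
      #M = Cardinal.lift.{w} (theoryCard L) ∧ IsCompleteType Set.univ p ∧
      ¬ Splits p (M : Set C) ∧ Splinters p (M : Set C) := by
  classical
  -- Over a finite `M'` all the `Q k` would be principal at finitely many tuples, yet they are
  -- pairwise distinct. Infinitude provides the elements that force the new model to have size at
  -- least `|J|`.
  have hinf : Infinite M' := by
    by_contra hfin
    rw [not_infinite_iff_finite] at hfin
    have hA : {a : Fin n → C' | ∀ i, a i ∈ (M' : Set C')}.Finite := by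
      have := Set.Finite.pi' (fun _ : Fin n => (Set.toFinite (M' : Set C')))
      exact this
    have : ∀ k, ∃ a : Fin n → C', (∀ i, a i ∈ (M' : Set C')) ∧ Q k = pure a := fun k =>
      Ultrafilter.eq_pure_of_finite_mem hA (hQM k)
    choose a ha hQa using this
    have : Set.InjOn a Set.univ := by
      intro k _ l _ hkl
      by_contra hne
      obtain ⟨θ, -, b, h1, h2⟩ := hF k l hne
      rw [hQa, hkl, ← hQa] at h1
      exact h2 h1
    exact Set.infinite_univ (Set.Finite.of_finite_image (hA.subset (by
      rintro _ ⟨k, -, rfl⟩; exact ha k)) this)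
  let m : ℕ ↪ M' := Infinite.natEmbedding M'
  obtain ⟨θ, b, hθ⟩ : ∃ (θ : ℕ → ℕ → L.Formula (Fin N ⊕ Fin n)) (b : ℕ → ℕ → Fin N → C'),
      ∀ k l, θ k l ∈ F ∧ (k ≠ l → (∀ᶠ a in Q k, (θ k l).Realize (Sum.elim (b k l) a)) ∧
        ¬ ∀ᶠ a in Q l, (θ k l).Realize (Sum.elim (b k l) a)) := by
    have : ∀ k l, ∃ (θ : L.Formula (Fin N ⊕ Fin n)) (b : Fin N → C'),
        θ ∈ F ∧ (k ≠ l → (∀ᶠ a in Q k, θ.Realize (Sum.elim b a)) ∧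
        ¬ ∀ᶠ a in Q l, θ.Realize (Sum.elim b a)) := by
      intro k l
      by_cases hkl : k = l
      -- A junk value on the diagonal, kept inside `F` so that the pigeonhole argument below applies
      -- to every `ω`.
      · obtain ⟨θ, hθ, b, -⟩ := hF 0 1 zero_ne_one
        exact ⟨θ, b, hθ, fun h => absurd hkl h⟩
      · obtain ⟨θ, hθ, b, h⟩ := hF k l hkl
        exact ⟨θ, b, hθ, fun _ => h⟩
    choose θ b h using this
    exact ⟨θ, b, h⟩
  obtain ⟨c, hc⟩ : ∃ c, Cardinal.lift.{w} (theoryCard L) = c := ⟨_, rfl⟩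
  have hc0 : ℵ₀ ≤ c := by
    rw [← hc, aleph0_le_lift]; exact le_max_left _ _
  obtain ⟨J, _, τ, hJ, ⟨j₀⟩, hτ⟩ := exists_linearOrder_orderIso c hc0
  obtain ⟨V, hV, hVne⟩ := exists_invariant_ultrafilter J
  -- Generators: elements of `M'` indexed by `J`, parameters for the consecutive pairs `(j, τ j)`,
  -- and the constant tuple `d`.
  let α : Type (max u v w) := J ⊕ (J × Fin N ⊕ Fin n)
  let g : α → (J → ℕ) → C' := Sum.elim (fun j ω => m (ω j))
    (Sum.elim (fun p ω => b (ω p.1) (ω (τ p.1)) p.2) fun i _ => d i)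
  let f : α ≃ α := Equiv.sumCongr τ.toEquiv
    (Equiv.sumCongr (Equiv.prodCongr τ.toEquiv (Equiv.refl _)) (Equiv.refl _))
  have hgf : ∀ a ω, g (f a) ω = g a (ω ∘ τ) := by
    rintro (j | p | i) ω <;> rfl
  have hg : ∀ a, ∃ S : Finset J, DependsOn (g a) S := by
    rintro (j | p | i)
    · exact ⟨{j}, fun x y h => by simp only [g, Sum.elim_inl, h j (by simp)]⟩
    · exact ⟨{p.1, τ p.1}, fun x y h => by
        simp only [g, Sum.elim_inl, Sum.elim_inr, h p.1 (by simp), h (τ p.1) (by simp)]⟩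
    · exact ⟨∅, fun x y h => rfl⟩
  have : Nonempty (M' : Set C') := (m 0 : M') |> fun x => ⟨x⟩
  let X := (skolemLanguage L).Term α
  let val : X → (J → ℕ) → C' := fun x ω => skolemVal (L := L) (M' : Set C') (fun a => g a ω) x
  let e : X → X := Term.relabel f
  have hval_e : ∀ x ω, val (e x) ω = val x (ω ∘ τ) := by
    intro x ω
    refine (skolemVal_relabel _ _ _).trans ?_
    exact congrArg (fun h => skolemVal (L := L) (M' : Set C') h x) (funext fun a => hgf a ω)
  have hvalS : ∀ x, ∃ S : Finset J, DependsOn (val x) S := exists_dependsOn_skolemVal g hg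
  have hαc : #α ≤ c := by
    have h1 : #(J × Fin N) ≤ c := by
      rw [mk_prod]
      refine mul_le_of_le hc0 (by simp [hJ]) (le_trans (by simp) hc0)
    simp only [α, mk_sum]
    refine add_le_of_le hc0 (by simp [hJ]) ?_
    rw [lift_id']
    refine add_le_of_le hc0 (by simpa using h1) (le_trans (by simp) hc0)
  have hXc : #X ≤ c := card_skolemTerm_le hc hαc
  have hXκ : #X < κ := hXc.trans_lt (hc ▸ hC.card_lt)
  obtain ⟨ι, hι⟩ := exists_realization hT hC V hXκ val
  have hι_inv : ∀ φ : L.Formula X, φ.Realize (ι ∘ e) ↔ φ.Realize ι := by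
    intro φ
    have h1 := hι (φ.relabel e)
    rw [Formula.realize_relabel] at h1
    rw [h1, hι, ← hV τ _ (exists_dependsOn_formula val hvalS φ)]
    refine Filter.eventually_congr (Filter.Eventually.of_forall fun ω => ?_)
    rw [Formula.realize_relabel]
    exact iff_of_eq (congrArg _ (funext fun x => hval_e x ω))
  have hι_eq : ∀ x y, ι x = ι y ↔ ∀ᶠ ω in V, val x ω = val y ω := by
    intro x y
    have := hι (Term.equal (Term.var x) (Term.var y))
    simpa only [Formula.realize_equal, Term.realize_var] using this
  have he_eq : ∀ x y, ι x = ι y → ι (e x) = ι (e y) := by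
    intro x y h
    have := hι_inv (Term.equal (Term.var x) (Term.var y))
    simp only [Formula.realize_equal, Term.realize_var] at this
    exact this.2 h
  obtain ⟨σ, hσ⟩ : ∃ σ : C ≃[L] C, ∀ x, σ (ι x) = ι (e x) := by
    -- The elementary map is defined through chosen preimages; `he_eq` makes it independent of the
    -- choice.
    have hs : ∀ a : Set.range ι, ∃ x, ι x = a := fun a => a.2
    choose s hs using hs
    obtain ⟨σ, hσ⟩ := hC.homogeneous (Set.range ι) (mk_range_le.trans_lt hXκ)
      (fun a => ι (e (s a))) (fun φ => by
        have h1 := hι_inv (φ.relabel s)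
        rw [Formula.realize_relabel, Formula.realize_relabel] at h1
        rw [show ι ∘ s = Subtype.val from funext hs] at h1
        exact h1.symm)
    refine ⟨σ, fun x => ?_⟩
    exact (hσ ⟨ι x, x, rfl⟩).trans (he_eq _ _ (hs _))
  let P : Set X := {x | ∀ᶠ ω in V, val x ω ∈ (M' : Set C')}
  have hPe : ∀ x, e x ∈ P ↔ x ∈ P := by
    intro x
    obtain ⟨S, hS⟩ := hvalS x
    have := hV τ (fun ω => val x ω ∈ (M' : Set C')) ⟨S, fun ω ω' h => by simp only [hS h]⟩
    refine Iff.trans ?_ this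
    exact Filter.eventually_congr (Filter.Eventually.of_forall fun ω => by rw [hval_e])
  -- Transfer principle: almost sure satisfiability in `M'` becomes satisfiability in the set `ι ''
  -- P`. It gives both the elementarity of `M` and finite satisfiability in `M`.
  have hsk : ∀ {r : ℕ} (Φ : L.Formula (X ⊕ Fin r)), (∀ᶠ ω in V, ∃ x : Fin r → C',
      (∀ i, x i ∈ (M' : Set C')) ∧ Φ.Realize (Sum.elim (fun x => val x ω) x)) →
      ∃ s : Fin r → X, (∀ i, s i ∈ P) ∧ Φ.Realize (Sum.elim ι (ι ∘ s)) := by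
    intro r Φ hΦ
    obtain ⟨s, hs⟩ := exists_skolemTerm (M := (M' : Set C')) Φ
    refine ⟨s, fun i => Filter.Eventually.of_forall fun ω => (hs fun a => g a ω).1 i, ?_⟩
    have h1 := hι (Φ.relabel (Sum.elim id s))
    rw [Formula.realize_relabel, Sum.comp_elim, Function.comp_id] at h1
    rw [h1]
    filter_upwards [hΦ] with ω hω
    rw [Formula.realize_relabel, Sum.comp_elim, Function.comp_id]
    exact (hs fun a => g a ω).2 hω
  have hx : ∀ a : ι '' P, ∃ x ∈ P, ι x = a := fun a => a.2
  choose x hxP hxι using hx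
  obtain ⟨M, hM⟩ : ∃ M : L.ElementarySubstructure C, (M : Set C) = ι '' P := by
    refine exists_elementarySubstructure fun φ hφ => ?_
    obtain ⟨k, t, φ', hφ'⟩ := exists_finite_formula_sum.{u, v, max u v w} φ
    let Φ : L.Formula (X ⊕ Fin 1) := φ'.relabel (Sum.map (x ∘ t) id)
    have hΦ : ∀ z : Fin 1 → C, Φ.Realize (Sum.elim ι z) ↔ φ.Realize (Sum.elim Subtype.val z) := by
      intro z
      rw [Formula.realize_relabel, Sum.elim_comp_map, Function.comp_id, hφ', ← Function.comp_assoc,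
        show ι ∘ x = Subtype.val from funext hxι]
    obtain ⟨s, hsP, hs⟩ := hsk Φ (by
      have h1 : (Φ.iExs (Fin 1)).Realize ι := by
        obtain ⟨z, hz⟩ := hφ
        exact Formula.realize_iExs.2 ⟨z, (hΦ z).2 hz⟩
      rw [hι] at h1
      have h2 : ∀ᶠ ω in V, ∀ i, val (x (t i)) ω ∈ (M' : Set C') :=
        Filter.eventually_all.2 fun i => hxP _
      filter_upwards [h1, h2] with ω h1 h2
      simp only [Φ, Formula.realize_iExs, Formula.realize_relabel, Sum.elim_comp_map,
        Function.comp_id] at h1 ⊢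
      exact exists_mem_realize M' φ' _ h2 h1)
    exact ⟨ι ∘ s, ⟨_, hsP 0, rfl⟩, (hΦ _).1 hs⟩
  have hcard : #M = Cardinal.lift.{w} (theoryCard L) := by
    rw [hc]
    have h0 : #M = #(ι '' P) := by rw [← hM]; rfl
    rw [h0]
    refine le_antisymm (mk_image_le.trans ((mk_set_le P).trans hXc)) ?_
    rw [← hJ]
    refine mk_le_of_injective (f := fun j : J => (⟨ι (Term.var (Sum.inl j)), Term.var (Sum.inl j),
      Filter.Eventually.of_forall fun ω => (m (ω j)).2, rfl⟩ : ι '' P)) fun i j hij => ?_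
    by_contra hne
    have h1 := (hι_eq _ _).1 (congrArg Subtype.val hij)
    obtain ⟨ω, h1, h2⟩ := (h1.and (hVne i j hne)).exists
    exact h2 (m.injective (Subtype.ext h1))
  have hσM : σ '' (M : Set C) = M := by
    rw [hM]
    refine Set.Subset.antisymm ?_ ?_
    · rintro _ ⟨_, ⟨y, hy, rfl⟩, rfl⟩
      exact ⟨e y, (hPe y).2 hy, (hσ y).symm⟩
    · rintro _ ⟨y, hy, rfl⟩
      have h1 : e (Term.relabel f.symm y) = y := by
        simp [e, X]
      exact ⟨ι (Term.relabel f.symm y), ⟨_, (hPe _).1 (by rwa [h1]), rfl⟩, by rw [hσ, h1]⟩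
  obtain ⟨θ₀, -, hθ₀⟩ : ∃ θ₀ ∈ F, ∀ᶠ ω : J → ℕ in V, θ (ω j₀) (ω (τ j₀)) = θ₀ := by
    refine (Ultrafilter.eventually_exists_mem_iff hFfin).1 ?_
    exact Filter.Eventually.of_forall fun ω => ⟨_, (hθ _ _).1, rfl⟩
  have hθ₁ : ∀ᶠ ω : J → ℕ in V, θ (ω (τ j₀)) (ω (τ (τ j₀))) = θ₀ :=
    (hV τ (fun ω => θ (ω j₀) (ω (τ j₀)) = θ₀) ⟨{j₀, τ j₀}, fun ω ω' h => by
      simp only [h j₀ (by simp), h (τ j₀) (by simp)]⟩).2 hθ₀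
  let B : J → Fin N → X := fun j i => Term.var (Sum.inr (Sum.inl (j, i)))
  let D : Fin n → X := fun i => Term.var (Sum.inr (Sum.inr i))
  obtain ⟨p, hp⟩ := exists_not_splits_splinters (M := (M : Set C)) (d := ι ∘ D) (σ := σ) hσM
    (fun i => hσ _) θ₀ (ι ∘ B j₀) (by
      rintro _ ⟨⟨φ, rfl⟩, hφ⟩
      rw [sat_relabel_sumMap] at hφ
      obtain ⟨k, t, φ', hφ'⟩ := exists_finite_formula_sum.{u, v, max u v w} φ
      let x' : Fin k → X := fun i => x ⟨t i, hM ▸ (t i).2⟩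
      have hx' : ι ∘ x' = Subtype.val ∘ t := funext fun i => hxι _
      rw [hφ', ← hx'] at hφ
      let Φ : L.Formula (X ⊕ Fin n) := φ'.relabel (Sum.map x' id) ⊓
        ((θ₀.relabel (Sum.map (B j₀) id)).not ⊓ θ₀.relabel (Sum.map (B (τ j₀)) id))
      obtain ⟨s, hsP, hs⟩ := hsk Φ (by
        have h1 := hι (φ'.relabel (Sum.elim x' D))
        rw [Formula.realize_relabel, Sum.comp_elim] at h1
        have h2 : ∀ᶠ ω in V, ∀ i, val (x' i) ω ∈ (M' : Set C') :=
          Filter.eventually_all.2 fun i => hxP _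
        filter_upwards [h1.1 hφ, h2, hθ₀, hθ₁, hVne j₀ (τ j₀) (hτ _).symm,
          hVne (τ j₀) (τ (τ j₀)) (hτ _).symm] with ω h1 h2 h3 h4 h5 h6
        rw [Formula.realize_relabel, Sum.comp_elim] at h1
        have h7 : φ'.relabel (Sum.map (fun i => val (x' i) ω) id) ∈ tp L (M' : Set C') d := by
          refine ⟨⟨φ'.relabel (Sum.map (fun i => ⟨val (x' i) ω, h2 i⟩) id), ?_⟩, ?_⟩
          · refine (formula_relabel_relabel _ _ _).trans ?_
            rw [Sum.map_comp_map]
            rfl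
          · rw [sat_relabel_sumMap]
            exact h1
        have h8 := ((hθ _ _).2 h6).1
        have h9 := Ultrafilter.eventually_not.2 ((hθ _ _).2 h5).2
        rw [h4] at h8
        rw [h3] at h9
        -- The index `ω (τ j₀)` is second in the pair for `B j₀` and first in the pair for `B (τ
        -- j₀)`, so this one coheir rejects `θ₀` at the former and accepts it at the latter.
        have h10 : ∀ᶠ a in Q (ω (τ j₀)), Sat (φ'.relabel (Sum.map (fun i => val (x' i) ω) id)) a :=
          hQd _ h7
        obtain ⟨a, ⟨ha1, ha2⟩, ha3, ha4⟩ := (((hQM (ω (τ j₀))).and h10).and (h8.and h9)).exists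
        refine ⟨a, ha1, ?_⟩
        rw [sat_relabel_sumMap] at ha2
        simp only [Φ, Formula.realize_inf, Formula.realize_not, Formula.realize_relabel,
          Sum.elim_comp_map, Function.comp_id]
        exact ⟨ha2, ha4, ha3⟩)
      simp only [Φ, Formula.realize_inf, Formula.realize_not, Formula.realize_relabel,
          Sum.elim_comp_map, Function.comp_id] at hs
      refine ⟨ι ∘ s, fun i => hM ▸ ⟨_, hsP i, rfl⟩, ?_, hs.2.1, ?_⟩
      · rw [sat_relabel_sumMap, hφ', ← hx']
        exact hs.1
      · convert hs.2.2 using 3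
        funext i
        exact hσ _)
  exact ⟨M, p, hcard, hp⟩

end Construction

/-! ### From distinct local coheirs to separating formulas -/

section Coheirs

variable {L : FirstOrder.Language.{u, v}} {C : Type w} [L.Structure C] {n : ℕ}

theorem exists_ultrafilter_of_finSatIn {A : Set C} {r : Set (L.Formula (C ⊕ Fin n))}
    (h : FinSatIn A r) : ∃ W : Ultrafilter (Fin n → C),
      (∀ᶠ a : Fin n → C in W, ∀ i, a i ∈ A) ∧ r ⊆ averageType L W := by
  classical
  let S : Set (Set (Fin n → C)) := insert {a | ∀ i, a i ∈ A} ((fun ψ => {a | Sat ψ a}) '' r)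
  obtain ⟨W, hW⟩ := Ultrafilter.exists_ultrafilter_of_finite_inter_nonempty S (by
    intro R hR
    have : ∀ s : R, ∃ G : Finset (L.Formula (C ⊕ Fin n)), (G : Set _) ⊆ r ∧
        ∀ a : Fin n → C, (∀ i, a i ∈ A) → (∀ ψ ∈ G, Sat ψ a) → a ∈ (s : Set (Fin n → C)) := by
      intro s
      rcases hR s.2 with hs | ⟨ψ, hψ, hs⟩
      · exact ⟨∅, by simp, fun a ha _ => by rw [hs]; exact ha⟩
      · exact ⟨{ψ}, by simpa using hψ, fun a _ h => by rw [← hs]; exact h ψ (by simp)⟩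
    choose G hGr hG using this
    obtain ⟨a, haA, ha⟩ := h (Finset.univ.biUnion G) (by
      intro ψ hψ
      obtain ⟨s, -, hs⟩ := Finset.mem_biUnion.1 (Finset.mem_coe.1 hψ)
      exact hGr s hs)
    exact ⟨a, fun s hs => hG ⟨s, hs⟩ a haA fun ψ hψ =>
      ha ψ (Finset.mem_biUnion.2 ⟨⟨s, hs⟩, Finset.mem_univ _, hψ⟩)⟩)
  exact ⟨W, hW (Set.mem_insert _ _), fun ψ hψ => hW (Set.mem_insert_of_mem _ ⟨ψ, hψ, rfl⟩)⟩

/-- The instances of finitely many formulas are, up to equivalence, instances of finitely many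
formulas with a fixed division of the variables. -/
theorem exists_finite_instances [Nonempty C] (Δ : Finset (L.Formula ℕ)) (n : ℕ) :
    ∃ (N : ℕ) (F : Set (L.Formula (Fin N ⊕ Fin n))), F.Finite ∧
      ∀ ψ ∈ instances (Δ : Set (L.Formula ℕ)) n (Set.univ : Set C), ∃ θ ∈ F, ∃ b : Fin N → C,
        ∀ a : Fin n → C, θ.Realize (Sum.elim b a) ↔ Sat ψ a := by
  classical
  have h : ∀ φ : L.Formula ℕ, ∃ (k : ℕ) (t : Fin k → ℕ) (φ' : L.Formula (Fin k)),
      ∀ v : ℕ → C, φ.Realize v ↔ φ'.Realize (v ∘ t) := fun φ => by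
    obtain ⟨k, t, φ', h⟩ := exists_finite_formula.{u, v, w} φ
    exact ⟨k, t, φ', fun v => h v⟩
  choose k t φ' hφ' using h
  let N := Δ.sup k
  refine ⟨N, ⋃ φ ∈ Δ, Set.range fun π : Fin (k φ) → Fin N ⊕ Fin n => (φ' φ).relabel π,
    Δ.finite_toSet.biUnion fun φ _ => Set.finite_range _, ?_⟩
  rintro _ ⟨φ, hφ, s, rfl⟩
  have hk : k φ ≤ N := Finset.le_sup hφ
  let c₀ : C := Classical.arbitrary C
  -- Each variable occurrence that receives a parameter gets its own slot, so only finitely many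
  -- divisions `π` arise; the remaining slots are filled with `c₀`.
  let π : Fin (k φ) → Fin N ⊕ Fin n := fun i =>
    Sum.elim (fun _ => Sum.inl (Fin.castLE hk i)) Sum.inr (s (t φ i))
  let b : Fin N → C := fun j => if h : (j : ℕ) < k φ then
    Sum.elim Subtype.val (fun _ => c₀) (s (t φ ⟨j, h⟩)) else c₀
  refine ⟨_, Set.mem_biUnion hφ ⟨π, rfl⟩, b, fun a => ?_⟩
  rw [Sat, Formula.realize_relabel, Formula.realize_relabel, hφ']
  refine iff_of_eq (congrArg _ (funext fun i => ?_))
  rcases hs : s (t φ i) with c | x <;> simp [π, b, hs]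

theorem IsCompleteLocalType.not_mem {Δ : Set (L.Formula ℕ)} {A : Set C}
    {q : Set (L.Formula (C ⊕ Fin n))} (hq : IsCompleteLocalType Δ A q)
    {ψ : L.Formula (C ⊕ Fin n)} (h : ψ.not ∈ q) : ψ ∉ q := by
  classical
  intro h'
  obtain ⟨a, -, ha⟩ := hq.consistent {ψ, ψ.not} (by
    intro χ hχ
    simp only [Finset.coe_insert, Finset.coe_singleton, Set.mem_insert_iff,
      Set.mem_singleton_iff] at hχ
    rcases hχ with rfl | rfl <;> assumption)
  have h1 := ha ψ (by simp)
  have h2 : Sat ψ.not a := ha ψ.not (by simp)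
  rw [Sat, Formula.realize_not] at h2
  exact h2 h1

theorem IsCompleteLocalType.exists_instance_of_ne {Δ : Set (L.Formula ℕ)} {A : Set C}
    {q q' : Set (L.Formula (C ⊕ Fin n))} (hq : IsCompleteLocalType Δ A q)
    (hq' : IsCompleteLocalType Δ A q') (h : q ≠ q') :
    ∃ ψ ∈ instances Δ n A, (ψ ∈ q ∧ ψ.not ∈ q') ∨ (ψ.not ∈ q ∧ ψ ∈ q') := by
  by_contra! hne
  have key : ∀ ψ ∈ instances Δ n A, (ψ ∈ q ↔ ψ ∈ q') ∧ (ψ.not ∈ q ↔ ψ.not ∈ q') := by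
    intro ψ hψ
    obtain ⟨h1, h2⟩ := hne ψ hψ
    have h3 := hq.complete ψ hψ
    have h4 := hq'.complete ψ hψ
    have h5 := fun h => hq.not_mem (ψ := ψ) h
    have h6 := fun h => hq'.not_mem (ψ := ψ) h
    tauto
  refine h (Set.ext fun ψ => ⟨fun hψ => ?_, fun hψ => ?_⟩)
  · rcases hq.subset ψ hψ with hi | ⟨θ, hi, rfl⟩
    · exact (key ψ hi).1.1 hψ
    · exact (key θ hi).2.1 hψ
  · rcases hq'.subset ψ hψ with hi | ⟨θ, hi, rfl⟩
    · exact (key ψ hi).1.2 hψ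
    · exact (key θ hi).2.2 hψ

end Coheirs

theorem IsCompleteType.eq_tp {L : FirstOrder.Language.{u, v}} {C : Type w} [L.Structure C] {n : ℕ}
    {A : Set C} {p : Set (L.Formula (C ⊕ Fin n))} (hp : IsCompleteType A p) {d : Fin n → C}
    (hd : ∀ φ ∈ p, Sat φ d) : p = tp L A d := by
  refine Set.Subset.antisymm (fun ψ hψ => ⟨hp.subset hψ, hd ψ hψ⟩) fun ψ hψ => ?_
  refine (hp.complete ψ hψ.1).resolve_right fun h => ?_
  have := hd _ h
  rw [Sat, Formula.realize_not] at this
  exact this hψ.2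

/-! ### Medium directionality and the main theorem -/

section Theories

variable {L : FirstOrder.Language.{u, v}} {T : L.Theory}

theorem HasMediumDirectionality.not_small (h : HasMediumDirectionality.{u, v, w} T) :
    ¬ HasSmallDirectionality.{u, v, w} T := by
  intro hs
  -- An uncountable cardinal is needed: finite counts have supremum at most `ℵ₀`.
  let l : Cardinal.{max u v w} := max (Cardinal.lift.{w} (theoryCard L)) ℵ₁
  have h1 : l ≤ ℵ₀ := (h l (le_max_left _ _)).2 fun μ hμ => (hs l μ hμ).le
  exact absurd ((le_max_right _ _).trans h1) (not_le.2 (aleph0_lt_aleph_one))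

end Theories

end Directionality

theorem mainTheorem6 {L : FirstOrder.Language.{u, v}} (T : L.Theory) (hT : T.IsComplete)
    (hdir : Directionality.HasMediumDirectionality.{u, v, w} T ∨
      Directionality.HasLargeDirectionality.{u, v, w} T)
    (κ : Cardinal.{max u v w}) (C : Type (max u v w)) [L.Structure C]
    (hC : Directionality.IsMonster.{u, v, w} T κ C) :
    ∃ (M : L.ElementarySubstructure C) (n : ℕ) (p : Set (L.Formula (C ⊕ Fin n))),
      Cardinal.mk M = Cardinal.lift.{w} (Directionality.theoryCard L) ∧
      Directionality.IsCompleteType Set.univ p ∧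
      ¬ Directionality.Splits p (M : Set C) ∧
      Directionality.Splinters p (M : Set C) := by
  open Directionality FirstOrder.Language in
  have hsmall : ¬ HasSmallDirectionality.{u, v, w} T := hdir.elim (fun h => h.not_small) fun h => h.1
  simp only [HasSmallDirectionality, not_forall, not_lt] at hsmall
  obtain ⟨l, μ, ⟨C', _, κ', M', n, p, Δ, hC', hM', -, hp, rfl⟩, hinf⟩ := hsmall
  have := hC'.model
  have := hC'.nonempty
  obtain ⟨d, hd⟩ := hC'.saturated M' hM' n p hp.subset hp.consistent
  obtain rfl := hp.eq_tp hd
  rw [aleph0_le_mk_iff] at hinf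
  let q := Infinite.natEmbedding (uf (Δ : Set (L.Formula ℕ)) (M' : Set C') (tp L (M' : Set C') d))
  choose Q hQM hQ using fun k => exists_ultrafilter_of_finSatIn (q k).2.2
  obtain ⟨N, F, hF, hFΔ⟩ := exists_finite_instances (C := C') Δ n
  obtain ⟨M, r, h⟩ := exists_model_not_splits_splinters hT hC M' d Q hQM
    -- Negations are added because the separating formula must hold for the first index and fail for
    -- the second, whichever of the two types contains the instance.
    (fun k => Set.subset_union_right.trans (hQ k)) (F ∪ Formula.not '' F) (hF.union (hF.image _)) (by
      intro k l hkl
      obtain ⟨ψ, hψ, h⟩ := (q k).2.1.exists_instance_of_ne (q l).2.1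
        fun h => hkl (q.injective (Subtype.ext h))
      have hmem : ∀ k, ∀ χ ∈ (q k : Set (L.Formula (C' ⊕ Fin n))), ∀ᶠ a in Q k, Sat χ a :=
        fun k χ hχ => hQ k (Or.inl hχ)
      obtain ⟨θ, hθ, b, hb⟩ := hFΔ ψ hψ
      rcases h with ⟨h1, h2⟩ | ⟨h1, h2⟩
      · refine ⟨θ, Or.inl hθ, b, ?_, ?_⟩
        · exact (hmem k _ h1).mono fun a ha => (hb a).2 ha
        · refine Ultrafilter.eventually_not.1 ((hmem l _ h2).mono fun a ha => ?_)
          rw [hb]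
          exact Formula.realize_not.1 ha
      · refine ⟨θ.not, Or.inr ⟨θ, hθ, rfl⟩, b, ?_, ?_⟩
        · refine (hmem k _ h1).mono fun a ha => ?_
          rw [Formula.realize_not, hb]
          exact Formula.realize_not.1 ha
        · refine Ultrafilter.eventually_not.1 ((hmem l _ h2).mono fun a ha => ?_)
          rw [Formula.realize_not, not_not, hb]
          exact ha)
  exact ⟨M, n, r, h⟩
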